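/- Let $\mathcal H\neq 0$ be a complex Hilbert space and $U$ its group of unitary operators. For a skew-hermitian bounded operator $x$ on $\mathcal H$ put $\phi_+(x)=\max\operatorname{spec}(-ix)$, $\phi_-(x)=\min\operatorname{spec}(-ix)$ and $\mathcal H_\pm(x)=\{\xi\in\mathcal H: x\xi=i\phi_\pm(x)\xi\}$. For $u\in U$ with $-1\notin\operatorname{spec}(u)$ put $\theta_+(u)=\max\operatorname{spec}(-i\log u)$, $\theta_-(u)=\min\operatorname{spec}(-i\log u)$, where $\log$ is the principal branch, and $\mathcal H_\pm(u)=\{\xi\in\mathcal H: u\xi=e^{i\theta_\pm(u)}\xi\}$. Let $a<b$ and let $\gamma:[a,b]\to U$ be a piecewise $C^1$ curve (for the operator norm), that is, $[a,b]$ has a finite partition into closed subintervals on each of which $\gamma$ is $C^1$. Write $\dot\gamma_t$ for its derivative, where at $a$, at $b$ and at each corner $\dot\gamma_t$ denotes a one-sided derivative (either one, at a corner). Suppose that $\gamma_a=1$, $$\int_a^b\phi_+(\dot\gamma_t\gamma_t^{-1})\,dt<\pi\quad\text{and}\quad\int_a^b\phi_-(\dot\gamma_t\gamma_t^{-1})\,dt>-\pi.$$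 Then $-1\notin\operatorname{spec}(\gamma_b)$ and $$\theta_+(\gamma_b)\le\int_a^b\phi_+(\dot\gamma_t\gamma_t^{-1})\,dt,\qquad \theta_-(\gamma_b)\ge\int_a^b\phi_-(\dot\gamma_t\gamma_t^{-1})\,dt.$$ If $\theta_+(\gamma_b)=\int_a^b\phi_+(\dot\gamma_t\gamma_t^{-1})\,dt$, then $$\mathcal H_+(\gamma_b)=\bigcap_{t\in[a,b]}\mathcal H_+(\dot\gamma_t\gamma_t^{-1})=\bigcap_{t\in[a,b]}\mathcal H_+(\gamma_t^{-1}\dot\gamma_t),$$ and if $\theta_-(\gamma_b)=\int_a^b\phi_-(\dot\gamma_t\gamma_t^{-1})\,dt$, then $$\mathcal H_-(\gamma_b)=\bigcap_{t\in[a,b]}\mathcal H_-(\dot\gamma_t\gamma_t^{-1})=\bigcap_{t\in[a,b]}\mathcal H_-(\gamma_t^{-1}\dot\gamma_t).$$ -/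

import Mathlib

noncomputable section

namespace UnitaryCurve

/-- `f` is piecewise `C¹` on `[a, b]`: there is a partition `a = p 0 < p 1 < ⋯ < p n = b` such that
`f` is `C¹` on each closed subinterval (with one-sided derivatives at its endpoints).
In particular `f` is continuous on `[a, b]`. -/
def PiecewiseC1On {E : Type*} [NormedAddCommGroup E] [NormedSpace ℝ E]
    (f : ℝ → E) (a b : ℝ) : Prop :=
  ∃ (n : ℕ) (p : Fin (n + 1) → ℝ), StrictMono p ∧ p 0 = a ∧ p (Fin.last n) = b ∧
    ∀ i : Fin n, ContDiffOn ℝ 1 f (Set.Icc (p i.castSucc) (p i.succ))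

/-- `f'` is a derivative of `f` on `[a, b]`: at each `t ∈ [a, b]` the value `f' t` is the right
derivative of `f` at `t` (where `t < b`) or the left derivative of `f` at `t` (where `a < t`).
At an interior point where `f` is differentiable the two agree with the derivative; at a corner of
a piecewise `C¹` curve either one-sided derivative may be taken; at the endpoints it is the
one-sided derivative from inside `[a, b]`. -/
def IsDerivOn {E : Type*} [NormedAddCommGroup E] [NormedSpace ℝ E]
    (f f' : ℝ → E) (a b : ℝ) : Prop :=
  ∀ t ∈ Set.Icc a b,
    (t < b ∧ HasDerivWithinAt f (f' t) (Set.Ici t) t) ∨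
    (a < t ∧ HasDerivWithinAt f (f' t) (Set.Iic t) t)

variable {H : Type*} [NormedAddCommGroup H] [InnerProductSpace ℂ H]

/-- `φ₊ x = max spec (-i x)` for a skew-hermitian bounded operator `x`. The spectrum of `-i x` is
then a compact set of real numbers (nonempty if `H ≠ 0`), so the supremum is its maximum. -/
def phiPlus (x : H →L[ℂ] H) : ℝ :=
  sSup {r : ℝ | (r : ℂ) ∈ spectrum ℂ ((-Complex.I) • x)}

/-- `φ₋ x = min spec (-i x)` for a skew-hermitian bounded operator `x`. -/
def phiMinus (x : H →L[ℂ] H) : ℝ :=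
  sInf {r : ℝ | (r : ℂ) ∈ spectrum ℂ ((-Complex.I) • x)}

/-- The eigenspace `{ξ | x ξ = i φ₊(x) ξ}` of a skew-hermitian operator `x`. -/
def skewEigPlus (x : H →L[ℂ] H) : Submodule ℂ H :=
  Module.End.eigenspace (x : H →ₗ[ℂ] H) (Complex.I * (phiPlus x : ℂ))

/-- The eigenspace `{ξ | x ξ = i φ₋(x) ξ}` of a skew-hermitian operator `x`. -/
def skewEigMinus (x : H →L[ℂ] H) : Submodule ℂ H :=
  Module.End.eigenspace (x : H →ₗ[ℂ] H) (Complex.I * (phiMinus x : ℂ))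

variable [CompleteSpace H]

/-- The principal logarithm of a unitary operator `u` with `-1 ∉ spec u`, by the continuous
functional calculus. -/
def logU (u : unitary (H →L[ℂ] H)) : H →L[ℂ] H :=
  cfc Complex.log (u : H →L[ℂ] H)

/-- `θ₊ u = max spec (-i log u)`, for unitary `u` with `-1 ∉ spec u`. -/
def thetaPlus (u : unitary (H →L[ℂ] H)) : ℝ :=
  sSup {r : ℝ | (r : ℂ) ∈ spectrum ℂ ((-Complex.I) • logU u)}

/-- `θ₋ u = min spec (-i log u)`, for unitary `u` with `-1 ∉ spec u`. -/
def thetaMinus (u : unitary (H →L[ℂ] H)) : ℝ :=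
  sInf {r : ℝ | (r : ℂ) ∈ spectrum ℂ ((-Complex.I) • logU u)}

/-- The eigenspace `{ξ | u ξ = exp (i θ₊(u)) ξ}` of a unitary operator `u`. -/
def unitaryEigPlus (u : unitary (H →L[ℂ] H)) : Submodule ℂ H :=
  Module.End.eigenspace ((u : H →L[ℂ] H) : H →ₗ[ℂ] H)
    (Complex.exp (Complex.I * (thetaPlus u : ℂ)))

/-- The eigenspace `{ξ | u ξ = exp (i θ₋(u)) ξ}` of a unitary operator `u`. -/
def unitaryEigMinus (u : unitary (H →L[ℂ] H)) : Submodule ℂ H :=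
  Module.End.eigenspace ((u : H →L[ℂ] H) : H →ₗ[ℂ] H)
    (Complex.exp (Complex.I * (thetaMinus u : ℂ)))

/-- The right logarithmic derivative `γ'ₜ γₜ⁻¹`. -/
def rightLogDeriv (γ : ℝ → unitary (H →L[ℂ] H)) (γ' : ℝ → H →L[ℂ] H) (t : ℝ) : H →L[ℂ] H :=
  γ' t * ((γ t)⁻¹ : unitary (H →L[ℂ] H))

/-- The left logarithmic derivative `γₜ⁻¹ γ'ₜ`. -/
def leftLogDeriv (γ : ℝ → unitary (H →L[ℂ] H)) (γ' : ℝ → H →L[ℂ] H) (t : ℝ) : H →L[ℂ] H :=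
  ((γ t)⁻¹ : unitary (H →L[ℂ] H)) * γ' t

end UnitaryCurve

end

open UnitaryCurve

/-! Follow the orbit `γ t ξ` of a unit vector and remove its mean phase `C t = (∫ φ₊ + ∫ φ₋) / 2`.
If `x = γ' γ⁻¹`, the resulting curve on the unit sphere of the underlying real Hilbert space has
speed at most `‖x - i (φ₊ x + φ₋ x) / 2‖ ≤ (φ₊ x - φ₋ x) / 2` (`norm_sub_midpoint_le`). It therefore
sweeps an angle at most `L = (∫ φ₊ - ∫ φ₋) / 2 < π` (`angle_centredOrbit_le`). Thus `Re ⟪ξ, e^{-iC}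
γ_b ξ⟫ ≥ cos L` for all unit `ξ`, which confines the spectrum of `e^{-iC} γ_b` to the arc of
half-width `L` about `1` (`exists_phase_of_mem_spectrum`). Undoing the rotation gives arguments
between `C - L = ∫ φ₋` and `C + L = ∫ φ₊`.

If `γ_b ξ = e^{i(C ± L)} ξ`, the centred orbit joins `ξ` to `e^{± iL} ξ`, at angle `L`, with no
length to spare. It must follow the great circle, so `γ t ξ` is a phase times `ξ` for all `t`
(`apply_eq_phase_of_extremal`). Differentiation makes `ξ` a common eigenvector of the logarithmic
derivatives; the converse is uniqueness for a linear differential equation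
(`eigenspace_eq_iInf_of_rigid`). -/

open UnitaryCurve
open Set Filter Topology MeasureTheory

namespace UnitaryCurve

/-! ### Extremal spectral values of skew-hermitian operators -/

section Operators

variable {H : Type*} [NormedAddCommGroup H] [InnerProductSpace ℂ H]

lemma phiPlus_eq_sSup_spectrum_real (x : H →L[ℂ] H) :
    phiPlus x = sSup (spectrum ℝ ((-Complex.I) • x)) := by
  rw [phiPlus, ← spectrum.preimage_algebraMap ℂ]
  rfl

lemma phiMinus_eq_neg_phiPlus_neg (x : H →L[ℂ] H) : phiMinus x = -phiPlus (-x) := by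
  rw [phiMinus, phiPlus, ← Real.sInf_neg]
  congr 1
  ext r
  simp [smul_neg, ← spectrum.neg_eq]

variable [CompleteSpace H]

lemma isSelfAdjoint_neg_I_smul {x : H →L[ℂ] H} (hx : star x = -x) :
    IsSelfAdjoint ((-Complex.I) • x) := by
  simp [IsSelfAdjoint, star_smul, hx]

lemma phiPlus_units_conjugate (g : unitary (H →L[ℂ] H)) (x : H →L[ℂ] H) :
    phiPlus (((g⁻¹ : unitary (H →L[ℂ] H)) : H →L[ℂ] H) * (x * (g : H →L[ℂ] H))) = phiPlus x := by
  have h : (-Complex.I) • (((g⁻¹ : unitary (H →L[ℂ] H)) : H →L[ℂ] H) * (x * (g : H →L[ℂ] H))) =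
      (↑(Unitary.toUnits g)⁻¹ : H →L[ℂ] H) * ((-Complex.I) • x) * Unitary.toUnits g := by
    simp [mul_assoc]
  rw [phiPlus, phiPlus, h, spectrum.units_conjugate']

lemma spectrum_real_subset_Icc_phi {x : H →L[ℂ] H} (hx : star x = -x) :
    spectrum ℝ ((-Complex.I) • x) ⊆ Icc (phiMinus x) (phiPlus x) := by
  have hA := isSelfAdjoint_neg_I_smul hx
  have hc := ContinuousFunctionalCalculus.isCompact_spectrum (R := ℝ) ((-Complex.I) • x)
  intro r hr
  refine ⟨?_, phiPlus_eq_sSup_spectrum_real x ▸ le_csSup hc.bddAbove hr⟩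
  have h : phiMinus x = sInf (spectrum ℝ ((-Complex.I) • x)) := by
    rw [phiMinus, ← spectrum.preimage_algebraMap ℂ]
    rfl
  exact h ▸ csInf_le hc.bddBelow hr

variable [Nontrivial H]

/-- Passing to the operator order makes `phiPlus` subadditive under perturbation; the Lipschitz
bound and continuity below rest on this. -/
lemma phiPlus_le_iff {x : H →L[ℂ] H} (hx : star x = -x) {r : ℝ} :
    phiPlus x ≤ r ↔ (-Complex.I) • x ≤ algebraMap ℝ (H →L[ℂ] H) r := by
  have hA := isSelfAdjoint_neg_I_smul hx
  rw [phiPlus_eq_sSup_spectrum_real, le_algebraMap_iff_spectrum_le (ha := hA)]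
  exact csSup_le_iff (ContinuousFunctionalCalculus.isCompact_spectrum (R := ℝ) ((-Complex.I) • x)).bddAbove
    (ContinuousFunctionalCalculus.spectrum_nonempty _ hA)

lemma phiPlus_le_add_norm_sub {x y : H →L[ℂ] H} (hx : star x = -x) (hy : star y = -y) :
    phiPlus x ≤ phiPlus y + ‖x - y‖ := by
  rw [phiPlus_le_iff hx, map_add]
  have h1 := (phiPlus_le_iff hy).1 le_rfl
  have h2 : star (x - y) = -(x - y) := by rw [star_sub, hx, hy]; abel
  have h3 := (isSelfAdjoint_neg_I_smul h2).le_algebraMap_norm_self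
  rw [norm_smul] at h3
  simp only [norm_neg, Complex.norm_I, one_mul] at h3
  calc (-Complex.I) • x = (-Complex.I) • y + (-Complex.I) • (x - y) := by
        rw [← smul_add]; congr 1; abel
    _ ≤ _ := add_le_add h1 h3

lemma abs_phiPlus_sub_le {x y : H →L[ℂ] H} (hx : star x = -x) (hy : star y = -y) :
    |phiPlus x - phiPlus y| ≤ ‖x - y‖ := by
  have h1 := phiPlus_le_add_norm_sub hx hy
  have h2 := phiPlus_le_add_norm_sub hy hx
  rw [norm_sub_rev] at h2
  rw [abs_le]
  constructor <;> linarith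

lemma continuousOn_phiPlus : ContinuousOn (phiPlus (H := H)) {x | star x = -x} := by
  intro x hx
  rw [ContinuousWithinAt, tendsto_iff_norm_sub_tendsto_zero]
  refine squeeze_zero' (Eventually.of_forall fun _ => norm_nonneg _)
    (g := fun y => ‖y - x‖) ?_ ?_
  · filter_upwards [self_mem_nhdsWithin] with y hy using abs_phiPlus_sub_le hy hx
  · exact (tendsto_iff_norm_sub_tendsto_zero.1 tendsto_id).mono_left nhdsWithin_le_nhds

lemma continuousOn_phiMinus : ContinuousOn (phiMinus (H := H)) {x | star x = -x} := by
  have h : phiMinus (H := H) = fun x => -phiPlus (-x) := funext phiMinus_eq_neg_phiPlus_neg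
  rw [h]
  refine (continuousOn_phiPlus.comp continuous_neg.continuousOn fun x hx => ?_).neg
  have hx' : star x = -x := hx
  simp [hx']

lemma phiMinus_le_phiPlus {x : H →L[ℂ] H} (hx : star x = -x) : phiMinus x ≤ phiPlus x := by
  obtain ⟨r, hr⟩ := ContinuousFunctionalCalculus.spectrum_nonempty (R := ℝ) _
    (isSelfAdjoint_neg_I_smul hx)
  have := spectrum_real_subset_Icc_phi hx hr
  exact this.1.trans this.2

/-- Subtracting the midpoint of the numerical range makes the norm equal to its half-width. -/
lemma norm_sub_midpoint_le {x : H →L[ℂ] H} (hx : star x = -x) :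
    ‖x - (Complex.I * (((phiPlus x + phiMinus x) / 2 : ℝ) : ℂ)) • (1 : H →L[ℂ] H)‖ ≤
      (phiPlus x - phiMinus x) / 2 := by
  set c := (phiPlus x + phiMinus x) / 2 with hc
  have hA := isSelfAdjoint_neg_I_smul hx
  -- By functional calculus the norm is bounded by `|t - c|` on the spectrum, which lies in an
  -- interval centred at `c`.
  have h1 : cfc (fun t : ℝ => t - c) ((-Complex.I) • x) =
      (-Complex.I) • x - algebraMap ℝ (H →L[ℂ] H) c := by
    rw [cfc_sub _ _ _, cfc_id' ℝ _ hA, cfc_const _ _ hA]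
  have h2 : (-Complex.I) • (x - (Complex.I * (c : ℂ)) • (1 : H →L[ℂ] H)) =
      (-Complex.I) • x - algebraMap ℝ (H →L[ℂ] H) c := by
    rw [smul_sub, smul_smul, Algebra.algebraMap_eq_smul_one, ← Complex.coe_smul, ← mul_assoc]
    simp
  have h3 : ‖x - (Complex.I * (c : ℂ)) • (1 : H →L[ℂ] H)‖ =
      ‖(-Complex.I) • (x - (Complex.I * (c : ℂ)) • (1 : H →L[ℂ] H))‖ := by
    rw [norm_smul]; simp
  rw [h3, h2, ← h1]
  refine norm_cfc_le (by linarith [phiMinus_le_phiPlus hx]) fun t ht => ?_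
  have := spectrum_real_subset_Icc_phi hx ht
  rw [Real.norm_eq_abs, abs_le]
  constructor <;> linarith [this.1, this.2]

end Operators

/-! ### Numerical range and spectrum -/

section Spectrum

variable {H : Type*} [NormedAddCommGroup H] [InnerProductSpace ℂ H] [CompleteSpace H]

/-- A lower bound for the real part of the quadratic form bounds the real part of the spectrum. -/
lemma le_re_of_mem_spectrum {T : H →L[ℂ] H} {k : ℝ}
    (h : ∀ ξ : H, ‖ξ‖ = 1 → k ≤ (inner ℂ ξ (T ξ)).re) {z : ℂ} (hz : z ∈ spectrum ℂ T) :
    k ≤ z.re := by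
  by_contra! hlt
  have h' : ∀ ξ : H, k * ‖ξ‖ ^ 2 ≤ (inner ℂ ξ (T ξ)).re := by
    intro ξ
    rcases eq_or_ne ξ 0 with rfl | hξ
    · simp
    have hn : ‖ξ‖ ≠ 0 := norm_ne_zero_iff.2 hξ
    have := h ((‖ξ‖⁻¹ : ℂ) • ξ) (by simp [norm_smul, hn])
    rw [map_smul, inner_smul_left, inner_smul_right, map_inv₀, Complex.conj_ofReal,
      ← Complex.ofReal_inv, Complex.re_ofReal_mul, Complex.re_ofReal_mul] at this
    calc k * ‖ξ‖ ^ 2 ≤ (‖ξ‖⁻¹ * (‖ξ‖⁻¹ * (inner ℂ ξ (T ξ)).re)) * ‖ξ‖ ^ 2 := by gcongr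
      _ = _ := by field_simp
  rw [spectrum.mem_iff, ← IsUnit.neg_iff, neg_sub] at hz
  -- If `Re z < k`, the form of `T - z` is coercive with constant `k - Re z`, so `T - z` is
  -- invertible.
  refine hz (ContinuousLinearMap.isUnit_of_forall_le_norm_inner_map _
    (c := (k - z.re).toNNReal) (Real.toNNReal_pos.2 (sub_pos.2 hlt)) fun ξ => ?_)
  rw [← norm_inner_symm]
  refine le_trans ?_ (Complex.re_le_norm _)
  have e : (inner ℂ ξ (z • ξ)).re = z.re * ‖ξ‖ ^ 2 := by
    have h1 : (inner ℂ ξ ξ).re = ‖ξ‖ ^ 2 := inner_self_eq_norm_sq (𝕜 := ℂ) ξ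
    have h2 : (inner ℂ ξ ξ).im = 0 := inner_self_im (𝕜 := ℂ) ξ
    rw [inner_smul_right, Complex.mul_re, h1, h2, mul_zero, sub_zero]
  have e2 : (T - algebraMap ℂ (H →L[ℂ] H) z) ξ = T ξ - z • ξ := by
    simp [Algebra.algebraMap_eq_smul_one]
  rw [e2, inner_sub_right, Complex.sub_re, e]
  rw [Real.coe_toNNReal _ (sub_pos.2 hlt).le]
  linarith [h' ξ]

end Spectrum

/-! ### Angles and lengths on the unit sphere -/

section Sphere

variable {E : Type*} [NormedAddCommGroup E] [InnerProductSpace ℝ E]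

lemma angle_eq_two_mul_arcsin {x y : E} (hx : ‖x‖ = 1) (hy : ‖y‖ = 1) :
    InnerProductGeometry.angle x y = 2 * Real.arcsin (‖x - y‖ / 2) := by
  set θ := InnerProductGeometry.angle x y with hθ
  have h0 : 0 ≤ θ := InnerProductGeometry.angle_nonneg x y
  have hpi : θ ≤ Real.pi := InnerProductGeometry.angle_le_pi x y
  have hc : Real.cos θ = inner ℝ x y := by
    rw [hθ, InnerProductGeometry.cos_angle, hx, hy]; simp
  have hs : ‖x - y‖ / 2 = Real.sin (θ / 2) := by
    have h1 : 0 ≤ Real.sin (θ / 2) :=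
      Real.sin_nonneg_of_nonneg_of_le_pi (by linarith) (by linarith)
    have h2 : (‖x - y‖ / 2) ^ 2 = Real.sin (θ / 2) ^ 2 := by
      rw [Real.sin_sq_eq_half_sub, mul_div_cancel₀ _ two_ne_zero, hc, div_pow,
        norm_sub_sq_real, hx, hy]
      ring
    exact (sq_eq_sq₀ (by positivity) h1).1 h2
  rw [hs, Real.arcsin_sin (by linarith) (by linarith)]
  ring

/-- Arc and chord agree to first order at `0`, so any factor above `1` absorbs the difference. -/
lemma eventually_two_mul_arcsin_le {k : ℝ} (hk : 1 < k) :
    ∀ᶠ y in 𝓝 (0 : ℝ), 0 ≤ y → 2 * Real.arcsin (y / 2) ≤ k * y := by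
  have h : HasDerivAt (fun y : ℝ => 2 * Real.arcsin (y / 2)) 1 0 := by
    have h1 : HasDerivAt Real.arcsin (1 / √(1 - (0 / 2 : ℝ) ^ 2)) (0 / 2 : ℝ) :=
      Real.hasDerivAt_arcsin (by norm_num) (by norm_num)
    have h2 := (h1.comp (0 : ℝ) ((hasDerivAt_id (0 : ℝ)).div_const 2)).const_mul 2
    have e : (2 : ℝ) * (1 / √(1 - (0 / 2 : ℝ) ^ 2) * (1 / 2)) = 1 := by norm_num
    rw [e] at h2
    exact h2
  filter_upwards [h.isLittleO.def (sub_pos.2 hk)] with y hy hy0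
  have := (le_abs_self _).trans hy
  simp only [zero_div, Real.arcsin_zero, mul_zero, sub_zero, smul_eq_mul, Real.norm_eq_abs,
    abs_of_nonneg hy0, mul_one] at this
  linarith

/-- On the unit sphere, the angle swept out by a curve is at most its length. -/
lemma angle_le_of_norm_deriv_right_le {v : ℝ → E} {S : ℝ → ℝ} {a b : ℝ}
    (hv : ContinuousOn v (Icc a b)) (hn : ∀ t ∈ Icc a b, ‖v t‖ = 1)
    (hS : ContinuousOn S (Icc a b))
    (hd : ∀ t ∈ Ico a b, ∃ (d : E) (l : ℝ), HasDerivWithinAt v d (Ici t) t ∧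
      HasDerivWithinAt S l (Ici t) t ∧ ‖d‖ ≤ l) {t : ℝ} (ht : t ∈ Icc a b) :
    InnerProductGeometry.angle (v a) (v t) ≤ S t - S a := by
  have ha : a ∈ Icc a b := ⟨le_rfl, ht.1.trans ht.2⟩
  choose! d l hdv hdS hdl using hd
  have hcont : ContinuousOn (fun t => InnerProductGeometry.angle (v a) (v t)) (Icc a b) := by
    refine ContinuousOn.congr (f := fun t => Real.arccos (inner ℝ (v a) (v t))) ?_ ?_
    · exact Real.continuous_arccos.comp_continuousOn (continuousOn_const.inner hv)
    · intro s hs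
      simp [InnerProductGeometry.angle, hn a ha, hn s hs]
  refine image_le_of_liminf_slope_right_le_deriv_boundary hcont
    (B := fun t => S t - S a) (B' := l) ?_ (hS.sub continuousOn_const)
    (fun x hx => (hdS x hx).sub_const _) ?_ ht
  · have : v a ≠ 0 := norm_ne_zero_iff.1 (by rw [hn a ha]; exact one_ne_zero)
    simp [InnerProductGeometry.angle_self this]
  · intro x hx r hr
    -- The gap is split in two: chords have slope below `q`, and the factor `r / q > 1` pays for
    -- replacing chords by arcs.
    obtain ⟨q, hq, hqr⟩ := exists_between ((hdl x hx).trans_lt hr)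
    have hq0 : 0 < q := (norm_nonneg _).trans_lt hq
    refine Eventually.frequently ?_
    have hslope : Tendsto (fun z => ‖slope v x z‖) (𝓝[>] x) (𝓝 ‖d x‖) := by
      exact (((hasDerivWithinAt_iff_tendsto_slope' (self_notMem_Ioi)).1
        (hasDerivWithinAt_Ioi_iff_Ici.2 (hdv x hx)))).norm
    have hzero : Tendsto (fun z => ‖v x - v z‖) (𝓝[>] x) (𝓝 0) := by
      have hc : ContinuousWithinAt v (Ioi x) x :=
        (hdv x hx).continuousWithinAt.mono Ioi_subset_Ici_self
      have := (tendsto_const_nhds (x := v x)).sub hc.tendsto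
      simpa using this.norm
    have hin : ∀ᶠ z in 𝓝[>] x, z ∈ Ioc x b := Ioc_mem_nhdsGT hx.2
    filter_upwards [hslope.eventually_lt_const hq, hin,
      hzero.eventually (eventually_two_mul_arcsin_le ((one_lt_div hq0).2 hqr))] with z hz hzb harc
    have hzx : 0 < z - x := sub_pos.2 hzb.1
    have hzI : z ∈ Icc a b := ⟨hx.1.trans hzb.1.le, hzb.2⟩
    have hxI : x ∈ Icc a b := ⟨hx.1, hx.2.le⟩
    have h1 := InnerProductGeometry.angle_le_angle_add_angle (v a) (v x) (v z)
    rw [angle_eq_two_mul_arcsin (hn x hxI) (hn z hzI)] at h1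
    have h2 := harc (norm_nonneg _)
    have h3 : ‖v x - v z‖ = (z - x) * ‖slope v x z‖ := by
      rw [slope_def_module, norm_smul, norm_inv, Real.norm_of_nonneg hzx.le, norm_sub_rev]
      field_simp
    rw [slope_def_field, div_lt_iff₀ hzx]
    calc _ ≤ r / q * ((z - x) * ‖slope v x z‖) := by rw [← h3]; linarith
      _ < r / q * ((z - x) * q) := by
          have : 0 < r / q := div_pos (hq0.trans hqr) hq0
          gcongr
      _ = r * (z - x) := by field_simp

/-- Equality in the spherical triangle inequality, for a pair of points at distance `L < π`
on the great circle spanned by the orthonormal pair `ξ`, `ζ`. -/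
lemma eq_cos_smul_add_sin_smul {ξ ζ u : E} (hξ : ‖ξ‖ = 1) (hζ : ‖ζ‖ = 1) (hu : ‖u‖ = 1)
    (ho : inner ℝ ξ ζ = 0) {s L : ℝ} (hs0 : 0 ≤ s) (hsL : s ≤ L) (hL : L < Real.pi)
    (h1 : InnerProductGeometry.angle ξ u ≤ s)
    (h2 : InnerProductGeometry.angle u (Real.cos L • ξ + Real.sin L • ζ) ≤ L - s) :
    u = Real.cos s • ξ + Real.sin s • ζ := by
  have hξξ : inner ℝ ξ ξ = 1 := by rw [real_inner_self_eq_norm_sq, hξ, one_pow]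
  have hζζ : inner ℝ ζ ζ = 1 := by rw [real_inner_self_eq_norm_sq, hζ, one_pow]
  have ho' : inner ℝ ζ ξ = 0 := by rw [real_inner_comm, ho]
  have hη : ∀ r : ℝ, ‖Real.cos r • ξ + Real.sin r • ζ‖ = 1 := by
    intro r
    have : ‖Real.cos r • ξ + Real.sin r • ζ‖ ^ 2 = 1 := by
      rw [← real_inner_self_eq_norm_sq]
      simp only [inner_add_left, inner_add_right, real_inner_smul_left, real_inner_smul_right,
        hξξ, hζζ, ho, ho']
      nlinarith [Real.sin_sq_add_cos_sq r]
    exact (pow_eq_one_iff_of_nonneg (norm_nonneg _) two_ne_zero).1 this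
  set η := Real.cos L • ξ + Real.sin L • ζ with hηdef
  have hangle : InnerProductGeometry.angle ξ η = L := by
    rw [InnerProductGeometry.angle, hξ, hη, hηdef, inner_add_right, real_inner_smul_right,
      real_inner_smul_right, hξξ, ho]
    simp [Real.arccos_cos (hs0.trans hsL) hL.le]
  have htri := InnerProductGeometry.angle_le_angle_add_angle ξ u η
  -- The triangle inequality through `u` leaves no slack, so both angle bounds are equalities.
  have e1 : InnerProductGeometry.angle ξ u = s := by linarith
  have e2 : InnerProductGeometry.angle u η = L - s := by linarith
  have c1 : inner ℝ u ξ = Real.cos s := by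
    rw [← e1, InnerProductGeometry.cos_angle, hξ, hu, real_inner_comm]; simp
  have c2 : Real.cos L * inner ℝ u ξ + Real.sin L * inner ℝ u ζ = Real.cos (L - s) := by
    rw [← e2, InnerProductGeometry.cos_angle, hη, hu, hηdef, inner_add_right,
      real_inner_smul_right, real_inner_smul_right]; simp
  -- The factor `sin s` covers `L = 0`, where `u` has no prescribed `ζ`-component. With `c1`, this
  -- makes the inner product of `u` and the target equal to `1`, and two unit vectors with inner
  -- product `1` coincide.
  have c3 : Real.sin s * (inner ℝ u ζ - Real.sin s) = 0 := by
    rcases (hs0.trans hsL).eq_or_lt with h0 | h0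
    · have : s = 0 := by linarith
      simp [this]
    · rw [c1, Real.cos_sub] at c2
      have hsin : Real.sin L ≠ 0 := (Real.sin_pos_of_pos_of_lt_pi h0 hL).ne'
      have : inner ℝ u ζ = Real.sin s := mul_left_cancel₀ hsin (by linarith)
      rw [this]; ring
  have : ‖u - (Real.cos s • ξ + Real.sin s • ζ)‖ ^ 2 = 0 := by
    rw [norm_sub_sq_real, hu, hη, inner_add_right, real_inner_smul_right, real_inner_smul_right, c1]
    nlinarith [Real.sin_sq_add_cos_sq s]
  exact sub_eq_zero.1 (norm_eq_zero.1 (pow_eq_zero_iff two_ne_zero |>.1 this))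

end Sphere

/-! ### One-sided calculus for piecewise `C¹` curves -/

section Piecewise

variable {E : Type*} [NormedAddCommGroup E] [NormedSpace ℝ E] {f f' : ℝ → E} {a b : ℝ}

lemma PiecewiseC1On.exists_contDiffOn_right (hf : PiecewiseC1On f a b) {t : ℝ}
    (ht : t ∈ Ico a b) : ∃ d, t < d ∧ d ≤ b ∧ ContDiffOn ℝ 1 f (Icc t d) := by
  obtain ⟨n, p, hp, h0, hn, hc⟩ := hf
  obtain ⟨i, hi, hmax⟩ := (Set.toFinite {i | p i ≤ t}).exists_maximal ⟨0, h0.le.trans ht.1⟩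
  have hne : i ≠ Fin.last n := by
    rintro rfl
    exact absurd (hn ▸ hi : b ≤ t) (not_le.2 ht.2)
  obtain ⟨j, rfl⟩ := Fin.exists_castSucc_eq.2 hne
  have hlt : t < p j.succ := by
    by_contra! hle
    exact absurd (hmax hle (Fin.castSucc_lt_succ (i := j)).le) (not_le.2 Fin.castSucc_lt_succ)
  exact ⟨p j.succ, hlt, hn ▸ hp.monotone (Fin.le_last _), (hc j).mono (Icc_subset_Icc_left hi)⟩

lemma PiecewiseC1On.exists_contDiffOn_left (hf : PiecewiseC1On f a b) {t : ℝ}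
    (ht : t ∈ Ioc a b) : ∃ c, a ≤ c ∧ c < t ∧ ContDiffOn ℝ 1 f (Icc c t) := by
  obtain ⟨n, p, hp, h0, hn, hc⟩ := hf
  obtain ⟨i, hi, hmin⟩ := (Set.toFinite {i | t ≤ p i}).exists_minimal
    ⟨Fin.last n, ht.2.trans hn.ge⟩
  have hne : i ≠ 0 := by
    rintro rfl
    exact absurd (h0 ▸ hi : t ≤ a) (not_le.2 ht.1)
  obtain ⟨j, rfl⟩ := Fin.exists_succ_eq.2 hne
  have hlt : p j.castSucc < t := by
    by_contra! hle
    exact absurd (hmin hle (Fin.castSucc_lt_succ (i := j)).le) (not_le.2 Fin.castSucc_lt_succ)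
  exact ⟨p j.castSucc, h0 ▸ hp.monotone (Fin.zero_le _), hlt,
    (hc j).mono (Icc_subset_Icc_right hi)⟩

lemma PiecewiseC1On.continuousOn (hf : PiecewiseC1On f a b) (hab : a < b) :
    ContinuousOn f (Icc a b) := by
  intro t ht
  have hR : ContinuousWithinAt f (Icc t b) t := by
    rcases ht.2.eq_or_lt with rfl | h
    · simp
    obtain ⟨d, h1, -, h3⟩ := hf.exists_contDiffOn_right ⟨ht.1, h⟩
    exact (h3.continuousOn t (left_mem_Icc.2 h1.le)).mono_of_mem_nhdsWithin
      (mem_of_superset (inter_mem self_mem_nhdsWithin (mem_nhdsWithin_of_mem_nhds (Iio_mem_nhds h1)))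
        fun x hx => ⟨hx.1.1, hx.2.le⟩)
  have hL : ContinuousWithinAt f (Icc a t) t := by
    rcases ht.1.eq_or_lt with rfl | h
    · simp
    obtain ⟨c, -, h2, h3⟩ := hf.exists_contDiffOn_left ⟨h, ht.2⟩
    exact (h3.continuousOn t (right_mem_Icc.2 h2.le)).mono_of_mem_nhdsWithin
      (mem_of_superset (inter_mem self_mem_nhdsWithin (mem_nhdsWithin_of_mem_nhds (Ioi_mem_nhds h2)))
        fun x hx => ⟨hx.2.le, hx.1.2⟩)
  rw [← Icc_union_Icc_eq_Icc ht.1 ht.2]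
  exact hL.union hR

/-- On a closed subinterval where `f` is `C¹`, any derivative in the sense of `IsDerivOn`
agrees in the interior with a continuous one. -/
lemma IsDerivOn.exists_continuousOn (hf' : IsDerivOn f f' a b) {c d : ℝ} (hcd : c < d)
    (hac : a ≤ c) (hdb : d ≤ b) (hf : ContDiffOn ℝ 1 f (Icc c d)) :
    ∃ g : ℝ → E, ContinuousOn g (Icc c d) ∧
      (∀ t ∈ Icc c d, HasDerivWithinAt f (g t) (Icc c d) t) ∧ EqOn f' g (Ioo c d) := by
  have hg : ∀ t ∈ Icc c d, HasDerivWithinAt f (derivWithin f (Icc c d) t) (Icc c d) t :=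
    fun t ht => (hf.differentiableOn one_ne_zero t ht).hasDerivWithinAt
  refine ⟨derivWithin f (Icc c d), hf.continuousOn_derivWithin (uniqueDiffOn_Icc hcd) le_rfl,
    hg, fun t ht => ?_⟩
  have h := (hg t (Ioo_subset_Icc_self ht)).hasDerivAt (Icc_mem_nhds ht.1 ht.2)
  rcases hf' t ⟨hac.trans ht.1.le, ht.2.le.trans hdb⟩ with ⟨-, h1⟩ | ⟨-, h1⟩
  · exact (uniqueDiffWithinAt_Ici t).eq_deriv _ h1 h.hasDerivWithinAt
  · exact (uniqueDiffWithinAt_Iic t).eq_deriv _ h1 h.hasDerivWithinAt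

/-- The limit is punctured because at a corner `f' t` may be the left derivative. -/
lemma IsDerivOn.exists_deriv_right (hf' : IsDerivOn f f' a b) (hf : PiecewiseC1On f a b) {t : ℝ}
    (ht : t ∈ Ico a b) :
    ∃ d, HasDerivWithinAt f d (Ici t) t ∧ Tendsto f' (𝓝[>] t) (𝓝 d) := by
  obtain ⟨e, hte, heb, hc⟩ := hf.exists_contDiffOn_right ht
  obtain ⟨g, hg, hgd, hfg⟩ := hf'.exists_continuousOn hte ht.1 heb hc
  refine ⟨g t, (hgd t (left_mem_Icc.2 hte.le)).mono_of_mem_nhdsWithin (Icc_mem_nhdsGE hte), ?_⟩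
  refine Tendsto.congr' (f₁ := g) ?_ ((hg t (left_mem_Icc.2 hte.le)).mono_left ?_)
  · filter_upwards [Ioo_mem_nhdsGT hte] with x hx using (hfg hx).symm
  · exact nhdsWithin_le_of_mem (mem_of_superset (Ioo_mem_nhdsGT hte) Ioo_subset_Icc_self)

lemma IsDerivOn.exists_deriv_left (hf' : IsDerivOn f f' a b) (hf : PiecewiseC1On f a b) {t : ℝ}
    (ht : t ∈ Ioc a b) :
    ∃ d, HasDerivWithinAt f d (Iic t) t ∧ Tendsto f' (𝓝[<] t) (𝓝 d) := by
  obtain ⟨e, hae, het, hc⟩ := hf.exists_contDiffOn_left ht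
  obtain ⟨g, hg, hgd, hfg⟩ := hf'.exists_continuousOn het hae ht.2 hc
  refine ⟨g t, (hgd t (right_mem_Icc.2 het.le)).mono_of_mem_nhdsWithin (Icc_mem_nhdsLE het), ?_⟩
  refine Tendsto.congr' (f₁ := g) ?_ ((hg t (right_mem_Icc.2 het.le)).mono_left ?_)
  · filter_upwards [Ioo_mem_nhdsLT het] with x hx using (hfg hx).symm
  · exact nhdsWithin_le_of_mem (mem_of_superset (Ioo_mem_nhdsLT het) Ioo_subset_Icc_self)

lemma IsDerivOn.tendsto_right (hf' : IsDerivOn f f' a b) (hf : PiecewiseC1On f a b) {t : ℝ}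
    (ht : t ∈ Ico a b) {d : E} (hd : HasDerivWithinAt f d (Ici t) t) :
    Tendsto f' (𝓝[>] t) (𝓝 d) := by
  obtain ⟨e, he, hlim⟩ := hf'.exists_deriv_right hf ht
  rwa [(uniqueDiffWithinAt_Ici t).eq_deriv _ hd he]

lemma IsDerivOn.tendsto_left (hf' : IsDerivOn f f' a b) (hf : PiecewiseC1On f a b) {t : ℝ}
    (ht : t ∈ Ioc a b) {d : E} (hd : HasDerivWithinAt f d (Iic t) t) :
    Tendsto f' (𝓝[<] t) (𝓝 d) := by
  obtain ⟨e, he, hlim⟩ := hf'.exists_deriv_left hf ht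
  rwa [(uniqueDiffWithinAt_Iic t).eq_deriv _ hd he]

/-- Local integrability plus compactness replaces an induction over the partition. -/
lemma integrableOn_Icc_of_one_sided {ψ : ℝ → ℝ}
    (hR : ∀ t ∈ Ico a b, ∃ d, t < d ∧ IntegrableOn ψ (Icc t d))
    (hL : ∀ t ∈ Ioc a b, ∃ c, c < t ∧ IntegrableOn ψ (Icc c t)) : IntegrableOn ψ (Icc a b) := by
  refine LocallyIntegrableOn.integrableOn_isCompact (fun t ht => ?_) isCompact_Icc
  have h1 : IntegrableAtFilter ψ (𝓝[Icc t b] t) := by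
    rcases ht.2.eq_or_lt with rfl | h
    · exact ⟨{t}, by simp, by simp⟩
    obtain ⟨d, h1, h2⟩ := hR t ⟨ht.1, h⟩
    exact ⟨Icc t d, mem_of_superset (inter_mem self_mem_nhdsWithin
      (mem_nhdsWithin_of_mem_nhds (Iio_mem_nhds h1))) fun x hx => ⟨hx.1.1, hx.2.le⟩, h2⟩
  have h2 : IntegrableAtFilter ψ (𝓝[Icc a t] t) := by
    rcases ht.1.eq_or_lt with rfl | h
    · exact ⟨{a}, by simp, by simp⟩
    obtain ⟨c, h1, h2⟩ := hL t ⟨h, ht.2⟩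
    exact ⟨Icc c t, mem_of_superset (inter_mem self_mem_nhdsWithin
      (mem_nhdsWithin_of_mem_nhds (Ioi_mem_nhds h1))) fun x hx => ⟨hx.2.le, hx.1.2⟩, h2⟩
  rw [← Icc_union_Icc_eq_Icc ht.1 ht.2, nhdsWithin_union]
  obtain ⟨s₁, hs₁, hi₁⟩ := h1
  obtain ⟨s₂, hs₂, hi₂⟩ := h2
  exact ⟨s₂ ∪ s₁, Filter.union_mem_sup hs₂ hs₁, hi₂.union hi₁⟩

lemma hasDerivWithinAt_integral_Ici {ψ : ℝ → ℝ} (hψ : IntegrableOn ψ (Icc a b)) {t l : ℝ}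
    (ht : t ∈ Ico a b) (hl : Tendsto ψ (𝓝[>] t) (𝓝 l)) :
    HasDerivWithinAt (fun u => ∫ r in a..u, ψ r) l (Ici t) t := by
  refine intervalIntegral.integral_hasDerivWithinAt_of_tendsto_ae_right (t := Ioi t) ?_ ?_
    (hl.mono_left inf_le_left)
  · exact (hψ.mono_set (by rw [uIcc_of_le ht.1]; exact Icc_subset_Icc_right ht.2.le)).intervalIntegrable
  · exact ⟨Ioo t b, Ioo_mem_nhdsGT ht.2,
      (hψ.mono_set (Ioo_subset_Icc_self.trans (Icc_subset_Icc_left ht.1))).aestronglyMeasurable⟩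

lemma hasDerivWithinAt_integral_Iic {ψ : ℝ → ℝ} (hψ : IntegrableOn ψ (Icc a b)) {t l : ℝ}
    (ht : t ∈ Ioc a b) (hl : Tendsto ψ (𝓝[<] t) (𝓝 l)) :
    HasDerivWithinAt (fun u => ∫ r in a..u, ψ r) l (Iic t) t := by
  refine intervalIntegral.integral_hasDerivWithinAt_of_tendsto_ae_right (t := Iic t) ?_ ?_
    (hl.mono_left ?_)
  · exact (hψ.mono_set (by
      rw [uIcc_of_le ht.1.le]; exact Icc_subset_Icc_right ht.2)).intervalIntegrable
  · exact ⟨Ioc a t, Ioc_mem_nhdsLE ht.1,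
      (hψ.mono_set (Ioc_subset_Icc_self.trans (Icc_subset_Icc_right ht.2))).aestronglyMeasurable⟩
  · have h : ({t}ᶜ : Set ℝ) ∈ ae (volume : Measure ℝ) := compl_mem_ae_iff.2 (measure_singleton t)
    calc 𝓝[≤] t ⊓ ae volume ≤ 𝓝[≤] t ⊓ 𝓟 {t}ᶜ := inf_le_inf_left _ (le_principal_iff.2 h)
      _ = 𝓝[<] t := by
        rw [nhdsWithin, inf_assoc, inf_principal, nhdsWithin, ← Set.sdiff_eq, Iic_sdiff_right]

end Piecewise

lemma hasDerivWithinAt_cexp {s : Set ℝ} {t : ℝ} {Φ : ℝ → ℝ} {l : ℝ}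
    (hΦ : HasDerivWithinAt Φ l s t) :
    HasDerivWithinAt (fun t => Complex.exp (Complex.I * (Φ t : ℂ)))
      (Complex.exp (Complex.I * (Φ t : ℂ)) * (Complex.I * (l : ℂ))) s t :=
  (hΦ.ofReal_comp.const_mul Complex.I).cexp

lemma hasDerivWithinAt_apply {H : Type*} [NormedAddCommGroup H] [InnerProductSpace ℂ H]
    {s : Set ℝ} {t : ℝ} {f : ℝ → H →L[ℂ] H} {d : H →L[ℂ] H}
    (hd : HasDerivWithinAt f d s t) (ξ : H) :
    HasDerivWithinAt (fun t => f t ξ) (d ξ) s t :=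
  ((ContinuousLinearMap.apply ℂ H ξ).restrictScalars ℝ).hasFDerivAt.comp_hasDerivWithinAt t hd

/-! ### Logarithmic derivatives and their accumulated phases -/

section LogDeriv

variable {H : Type*} [NormedAddCommGroup H] [InnerProductSpace ℂ H] [CompleteSpace H]
  {γ : ℝ → unitary (H →L[ℂ] H)} {γ' : ℝ → H →L[ℂ] H} {a b : ℝ}

/-- Differentiate `γ γ* = 1`. -/
lemma star_mul_inv_of_hasDerivWithinAt {d : H →L[ℂ] H} {s : Set ℝ} {t : ℝ}
    (hs : UniqueDiffWithinAt ℝ s t)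
    (hd : HasDerivWithinAt (fun t => (γ t : H →L[ℂ] H)) d s t) :
    star (d * ((γ t)⁻¹ : unitary (H →L[ℂ] H))) = -(d * ((γ t)⁻¹ : unitary (H →L[ℂ] H))) := by
  have h1 : HasDerivWithinAt (fun t => (γ t : H →L[ℂ] H) * star (γ t : H →L[ℂ] H))
      (d * star (γ t : H →L[ℂ] H) + (γ t : H →L[ℂ] H) * star d) s t := hd.mul hd.star
  have h2 : (fun t => (γ t : H →L[ℂ] H) * star (γ t : H →L[ℂ] H)) = fun _ => 1 := by
    ext1 t; exact Unitary.mul_star_self_of_mem (γ t).2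
  rw [h2] at h1
  have h3 := hs.eq_deriv _ h1 (hasDerivWithinAt_const t s 1)
  rw [← Unitary.star_eq_inv, Unitary.coe_star, star_mul, star_star]
  exact eq_neg_of_add_eq_zero_right h3

lemma IsDerivOn.star_rightLogDeriv (hγ' : IsDerivOn (fun t => (γ t : H →L[ℂ] H)) γ' a b) {t : ℝ}
    (ht : t ∈ Icc a b) : star (rightLogDeriv γ γ' t) = -rightLogDeriv γ γ' t := by
  rcases hγ' t ht with ⟨-, h⟩ | ⟨-, h⟩
  · exact star_mul_inv_of_hasDerivWithinAt (uniqueDiffWithinAt_Ici t) h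
  · exact star_mul_inv_of_hasDerivWithinAt (uniqueDiffWithinAt_Iic t) h

lemma continuousOn_coe_inv {s : Set ℝ} (h : ContinuousOn (fun t => (γ t : H →L[ℂ] H)) s) :
    ContinuousOn (fun t => (((γ t)⁻¹ : unitary (H →L[ℂ] H)) : H →L[ℂ] H)) s := by
  simpa only [← Unitary.star_eq_inv, Unitary.coe_star] using h.star

variable {ψ : (H →L[ℂ] H) → ℝ}

/-- Here `ψ` stands for `phiPlus` or `phiMinus`. On each closed piece the integrand agrees off the
endpoints with a continuous function. -/
lemma integrableOn_comp_rightLogDeriv (hψ : ContinuousOn ψ {x | star x = -x})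
    (hγ : PiecewiseC1On (fun t => (γ t : H →L[ℂ] H)) a b)
    (hγ' : IsDerivOn (fun t => (γ t : H →L[ℂ] H)) γ' a b) :
    IntegrableOn (fun t => ψ (rightLogDeriv γ γ' t)) (Icc a b) := by
  have key : ∀ c d, c < d → a ≤ c → d ≤ b →
      ContDiffOn ℝ 1 (fun t => (γ t : H →L[ℂ] H)) (Icc c d) →
      IntegrableOn (fun t => ψ (rightLogDeriv γ γ' t)) (Icc c d) := by
    intro c d hcd hac hdb hf
    obtain ⟨g, hg, hgd, hfg⟩ := hγ'.exists_continuousOn hcd hac hdb hf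
    have h1 : ContinuousOn (fun t => ψ (g t * ((γ t)⁻¹ : unitary (H →L[ℂ] H)))) (Icc c d) :=
      hψ.comp (hg.mul (continuousOn_coe_inv hf.continuousOn)) fun t ht =>
        star_mul_inv_of_hasDerivWithinAt (uniqueDiffOn_Icc hcd t ht) (hgd t ht)
    have h2 := h1.integrableOn_Icc (μ := volume)
    rw [integrableOn_Icc_iff_integrableOn_Ioo] at h2 ⊢
    refine h2.congr_fun (fun t ht => ?_) measurableSet_Ioo
    simp only [rightLogDeriv, hfg ht]
  refine integrableOn_Icc_of_one_sided (fun t ht => ?_) fun t ht => ?_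
  · obtain ⟨d, h1, h2, h3⟩ := hγ.exists_contDiffOn_right ht
    exact ⟨d, h1, key t d h1 ht.1 h2 h3⟩
  · obtain ⟨c, h1, h2, h3⟩ := hγ.exists_contDiffOn_left ht
    exact ⟨c, h2, key c t h2 h1 ht.2 h3⟩

lemma tendsto_coe_inv {u : Set ℝ} {t : ℝ}
    (h : ContinuousWithinAt (fun t => (γ t : H →L[ℂ] H)) u t) :
    Tendsto (fun r => (((γ r)⁻¹ : unitary (H →L[ℂ] H)) : H →L[ℂ] H)) (𝓝[u] t)
      (𝓝 ((γ t)⁻¹ : unitary (H →L[ℂ] H))) := by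
  simpa only [← Unitary.star_eq_inv, Unitary.coe_star] using h.tendsto.star

lemma tendsto_comp_rightLogDeriv (hψ : ContinuousOn ψ {x | star x = -x})
    (hγ' : IsDerivOn (fun t => (γ t : H →L[ℂ] H)) γ' a b) {t : ℝ} {s u : Set ℝ} {d : H →L[ℂ] H}
    (hs : UniqueDiffWithinAt ℝ s t) (hus : u ⊆ s) (hu : ∀ᶠ r in 𝓝[u] t, r ∈ Icc a b)
    (hd : HasDerivWithinAt (fun t => (γ t : H →L[ℂ] H)) d s t)
    (hlim : Tendsto γ' (𝓝[u] t) (𝓝 d)) :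
    Tendsto (fun r => ψ (rightLogDeriv γ γ' r)) (𝓝[u] t)
      (𝓝 (ψ (d * ((γ t)⁻¹ : unitary (H →L[ℂ] H))))) :=
  (hψ _ (star_mul_inv_of_hasDerivWithinAt hs hd)).tendsto.comp
    (tendsto_nhdsWithin_iff.2 ⟨hlim.mul (tendsto_coe_inv (hd.continuousWithinAt.mono hus)),
      hu.mono fun _ hr => hγ'.star_rightLogDeriv hr⟩)

lemma hasDerivWithinAt_phase_Ici (hψ : ContinuousOn ψ {x | star x = -x})
    (hγ : PiecewiseC1On (fun t => (γ t : H →L[ℂ] H)) a b)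
    (hγ' : IsDerivOn (fun t => (γ t : H →L[ℂ] H)) γ' a b) {t : ℝ} (ht : t ∈ Ico a b)
    {d : H →L[ℂ] H} (hd : HasDerivWithinAt (fun t => (γ t : H →L[ℂ] H)) d (Ici t) t) :
    HasDerivWithinAt (fun u => ∫ r in a..u, ψ (rightLogDeriv γ γ' r))
      (ψ (d * ((γ t)⁻¹ : unitary (H →L[ℂ] H)))) (Ici t) t := by
  refine hasDerivWithinAt_integral_Ici (integrableOn_comp_rightLogDeriv hψ hγ hγ') ht
    (tendsto_comp_rightLogDeriv hψ hγ' (uniqueDiffWithinAt_Ici t) Ioi_subset_Ici_self ?_ hd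
      (hγ'.tendsto_right hγ ht hd))
  filter_upwards [Ioo_mem_nhdsGT ht.2] with r hr using ⟨ht.1.trans hr.1.le, hr.2.le⟩

lemma hasDerivWithinAt_phase_Iic (hψ : ContinuousOn ψ {x | star x = -x})
    (hγ : PiecewiseC1On (fun t => (γ t : H →L[ℂ] H)) a b)
    (hγ' : IsDerivOn (fun t => (γ t : H →L[ℂ] H)) γ' a b) {t : ℝ} (ht : t ∈ Ioc a b)
    {d : H →L[ℂ] H} (hd : HasDerivWithinAt (fun t => (γ t : H →L[ℂ] H)) d (Iic t) t) :
    HasDerivWithinAt (fun u => ∫ r in a..u, ψ (rightLogDeriv γ γ' r))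
      (ψ (d * ((γ t)⁻¹ : unitary (H →L[ℂ] H)))) (Iic t) t := by
  refine hasDerivWithinAt_integral_Iic (integrableOn_comp_rightLogDeriv hψ hγ hγ') ht
    (tendsto_comp_rightLogDeriv hψ hγ' (uniqueDiffWithinAt_Iic t) Iio_subset_Iic_self ?_ hd
      (hγ'.tendsto_left hγ ht hd))
  filter_upwards [Ioo_mem_nhdsLT ht.1] with r hr using ⟨hr.1.le, hr.2.le.trans ht.2⟩

lemma continuousOn_phase (hab : a < b) (hψ : ContinuousOn ψ {x | star x = -x})
    (hγ : PiecewiseC1On (fun t => (γ t : H →L[ℂ] H)) a b)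
    (hγ' : IsDerivOn (fun t => (γ t : H →L[ℂ] H)) γ' a b) :
    ContinuousOn (fun u => ∫ r in a..u, ψ (rightLogDeriv γ γ' r)) (Icc a b) := by
  rw [← uIcc_of_le hab.le]
  exact intervalIntegral.continuousOn_primitive_interval
    ((uIcc_of_le hab.le).symm ▸ integrableOn_comp_rightLogDeriv hψ hγ hγ')

end LogDeriv

lemma tendsto_clm_apply {H : Type*} [NormedAddCommGroup H] [InnerProductSpace ℂ H]
    {l : Filter ℝ} {f : ℝ → H →L[ℂ] H} {g : ℝ → H} {d : H →L[ℂ] H} {η : H}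
    (hf : Tendsto f l (𝓝 d)) (hg : Tendsto g l (𝓝 η)) :
    Tendsto (fun r => f r (g r)) l (𝓝 (d η)) :=
  (isBoundedBilinearMap_apply (𝕜 := ℂ).continuous.tendsto (d, η)).comp (hf.prodMk_nhds hg)

/-! ### Vectors moved by a phase alone -/

section Eigenvectors

variable {H : Type*} [NormedAddCommGroup H] [InnerProductSpace ℂ H] [CompleteSpace H]
  {γ : ℝ → unitary (H →L[ℂ] H)} {γ' : ℝ → H →L[ℂ] H} {a b : ℝ}
  {ψ : (H →L[ℂ] H) → ℝ} {ξ : H}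

lemma unitary_apply_inv_apply (u : unitary (H →L[ℂ] H)) (ξ : H) :
    (u : H →L[ℂ] H) (((u⁻¹ : unitary (H →L[ℂ] H)) : H →L[ℂ] H) ξ) = ξ := by
  have h : (u : H →L[ℂ] H) * (u⁻¹ : unitary (H →L[ℂ] H)) = 1 := by
    rw [← Submonoid.coe_mul, mul_inv_cancel, Submonoid.coe_one]
  exact DFunLike.congr_fun h ξ

lemma unitary_inv_apply_apply (u : unitary (H →L[ℂ] H)) (ξ : H) :
    ((u⁻¹ : unitary (H →L[ℂ] H)) : H →L[ℂ] H) ((u : H →L[ℂ] H) ξ) = ξ := by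
  have := unitary_apply_inv_apply u⁻¹ ξ
  rwa [inv_inv] at this

lemma unitary_norm_apply (u : unitary (H →L[ℂ] H)) (ξ : H) : ‖(u : H →L[ℂ] H) ξ‖ = ‖ξ‖ :=
  ContinuousLinearMap.norm_map_of_mem_unitary u.2 ξ

lemma deriv_apply_of_apply_eq_phase {Φ : ℝ → ℝ} {t l : ℝ} {s : Set ℝ} {d : H →L[ℂ] H}
    (h : ∀ t ∈ Icc a b, (γ t : H →L[ℂ] H) ξ = Complex.exp (Complex.I * (Φ t : ℂ)) • ξ)
    (ht : t ∈ Icc a b) (hs : UniqueDiffWithinAt ℝ s t) (hmem : Icc a b ∈ 𝓝[s] t)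
    (hd : HasDerivWithinAt (fun t => (γ t : H →L[ℂ] H)) d s t) (hΦ : HasDerivWithinAt Φ l s t) :
    d ξ = (Complex.I * (l : ℂ)) • (γ t : H →L[ℂ] H) ξ := by
  have h1 : HasDerivWithinAt (fun t => Complex.exp (Complex.I * (Φ t : ℂ)) • ξ) (d ξ) s t :=
    (hasDerivWithinAt_apply hd ξ).congr_of_eventuallyEq
      (mem_of_superset hmem fun r hr => (h r hr).symm) (h t ht).symm
  rw [hs.eq_deriv _ h1 ((hasDerivWithinAt_cexp hΦ).smul_const ξ), h t ht, smul_smul, mul_comm]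

/-- If `γ` moves `ξ` only by the phase with density `ψ (γ'ₜ γₜ⁻¹)`, then `ξ` is an eigenvector of
the derivative at every time, including the one-sided derivatives at corners. -/
lemma deriv_apply_eq_of_phase (hψ : ContinuousOn ψ {x | star x = -x})
    (hγ : PiecewiseC1On (fun t => (γ t : H →L[ℂ] H)) a b)
    (hγ' : IsDerivOn (fun t => (γ t : H →L[ℂ] H)) γ' a b)
    (h : ∀ t ∈ Icc a b, (γ t : H →L[ℂ] H) ξ =
      Complex.exp (Complex.I * ((∫ r in a..t, ψ (rightLogDeriv γ γ' r) : ℝ) : ℂ)) • ξ)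
    {t : ℝ} (ht : t ∈ Icc a b) :
    γ' t ξ = (Complex.I * (ψ (rightLogDeriv γ γ' t) : ℂ)) • (γ t : H →L[ℂ] H) ξ := by
  rcases hγ' t ht with ⟨hlt, hd⟩ | ⟨hlt, hd⟩
  · exact deriv_apply_of_apply_eq_phase h ht (uniqueDiffWithinAt_Ici t)
      (mem_of_superset (Icc_mem_nhdsGE hlt) (Icc_subset_Icc_left ht.1)) hd
      (hasDerivWithinAt_phase_Ici hψ hγ hγ' ⟨ht.1, hlt⟩ hd)
  · exact deriv_apply_of_apply_eq_phase h ht (uniqueDiffWithinAt_Iic t)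
      (mem_of_superset (Icc_mem_nhdsLE hlt) (Icc_subset_Icc_right ht.2)) hd
      (hasDerivWithinAt_phase_Iic hψ hγ hγ' ⟨hlt, ht.2⟩ hd)

lemma rightLogDeriv_apply_eq_of_phase {t : ℝ} {z l : ℂ} (hz : z ≠ 0)
    (h : (γ t : H →L[ℂ] H) ξ = z • ξ) (hd : γ' t ξ = l • (γ t : H →L[ℂ] H) ξ) :
    rightLogDeriv γ γ' t ξ = l • ξ := by
  have h1 : (((γ t)⁻¹ : unitary (H →L[ℂ] H)) : H →L[ℂ] H) ξ = z⁻¹ • ξ := by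
    have := unitary_inv_apply_apply (γ t) ξ
    rw [h, map_smul] at this
    rw [eq_inv_smul_iff₀ hz, this]
  rw [rightLogDeriv, mul_apply_eq_comp, h1, map_smul, hd, h, smul_comm l z,
    inv_smul_smul₀ hz]

lemma leftLogDeriv_apply_eq_iff {t : ℝ} {l : ℂ} :
    leftLogDeriv γ γ' t ξ = l • ξ ↔ γ' t ξ = l • (γ t : H →L[ℂ] H) ξ := by
  rw [leftLogDeriv, mul_apply_eq_comp]
  constructor
  · intro h
    rw [← unitary_apply_inv_apply (γ t) (γ' t ξ), h, map_smul]
  · intro h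
    rw [h, map_smul, unitary_inv_apply_apply]

/-- The hypothesis amounts to `γ' ξ = i ψ γ ξ`, so `e^{-iΦ} γ ξ` has vanishing right derivative. -/
lemma apply_eq_phase_of_leftLogDeriv (hab : a < b) (hψ : ContinuousOn ψ {x | star x = -x})
    (hγ : PiecewiseC1On (fun t => (γ t : H →L[ℂ] H)) a b)
    (hγ' : IsDerivOn (fun t => (γ t : H →L[ℂ] H)) γ' a b) (hγa : γ a = 1)
    (h : ∀ t ∈ Icc a b, leftLogDeriv γ γ' t ξ =
      (Complex.I * (ψ (rightLogDeriv γ γ' t) : ℂ)) • ξ) {t : ℝ} (ht : t ∈ Icc a b) :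
    (γ t : H →L[ℂ] H) ξ =
      Complex.exp (Complex.I * ((∫ r in a..t, ψ (rightLogDeriv γ γ' r) : ℝ) : ℂ)) • ξ := by
  set Φ : ℝ → ℝ := fun t => ∫ r in a..t, ψ (rightLogDeriv γ γ' r) with hΦ
  have hcont : ContinuousOn (fun t => (γ t : H →L[ℂ] H) ξ) (Icc a b) :=
    (hγ.continuousOn hab).clm_apply continuousOn_const
  have hΦc : ContinuousOn (fun t => Complex.exp (Complex.I * ((-Φ t : ℝ) : ℂ))) (Icc a b) :=
    (continuousOn_const.mul (Complex.continuous_ofReal.comp_continuousOn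
      (continuousOn_phase hab hψ hγ hγ').neg)).cexp
  have hconst := constant_of_has_deriv_right_zero (hΦc.smul hcont) (fun x hx => by
    obtain ⟨d, hd, hlim⟩ := hγ'.exists_deriv_right hγ hx
    have h1 := hasDerivWithinAt_phase_Ici hψ hγ hγ' hx hd
    have hev : ∀ᶠ r in 𝓝[>] x, r ∈ Icc a b := by
      filter_upwards [Ioo_mem_nhdsGT hx.2] with r hr using ⟨hx.1.trans hr.1.le, hr.2.le⟩
    -- At a corner `h` may speak of the left derivative; the relation for the right derivative `d`
    -- is a limit from the right.
    have h2 : d ξ = (Complex.I * (ψ (d * ((γ x)⁻¹ : unitary (H →L[ℂ] H))) : ℂ)) •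
        (γ x : H →L[ℂ] H) ξ := by
      refine tendsto_nhds_unique_of_eventuallyEq (tendsto_clm_apply hlim tendsto_const_nhds)
        (((Complex.continuous_ofReal.tendsto _).comp (tendsto_comp_rightLogDeriv hψ hγ'
          (uniqueDiffWithinAt_Ici x) Ioi_subset_Ici_self hev hd hlim)).const_mul _ |>.smul
          (tendsto_clm_apply (hd.continuousWithinAt.mono Ioi_subset_Ici_self).tendsto
            tendsto_const_nhds))
        (hev.mono fun r hr => leftLogDeriv_apply_eq_iff.1 (h r hr))
    have h3 := (hasDerivWithinAt_cexp h1.neg).smul (hasDerivWithinAt_apply hd ξ)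
    refine h3.congr_deriv ?_
    rw [h2, smul_smul, ← add_smul]
    push_cast
    simp) t ht
  simp only [hγa, Submonoid.coe_one, one_apply_eq_self, hΦ,
    intervalIntegral.integral_same, neg_zero, Complex.ofReal_zero, mul_zero, Complex.exp_zero,
    one_smul, Pi.smul_apply'] at hconst
  have e := congrArg (Complex.exp (Complex.I * (Φ t : ℂ)) • ·) hconst
  simp only [smul_smul, ← Complex.exp_add] at e
  simpa [hΦ] using e

/-- The hypothesis does not give `γ' ξ` directly, so the adjoint orbit is used: `(γ*)' = -γ* (γ'
γ⁻¹)` shows that `e^{iΦ} γ* ξ` is constant. Applying `γ` to this constant recovers the claim. -/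
lemma apply_eq_phase_of_rightLogDeriv (hab : a < b) (hψ : ContinuousOn ψ {x | star x = -x})
    (hγ : PiecewiseC1On (fun t => (γ t : H →L[ℂ] H)) a b)
    (hγ' : IsDerivOn (fun t => (γ t : H →L[ℂ] H)) γ' a b) (hγa : γ a = 1)
    (h : ∀ t ∈ Icc a b, rightLogDeriv γ γ' t ξ =
      (Complex.I * (ψ (rightLogDeriv γ γ' t) : ℂ)) • ξ) {t : ℝ} (ht : t ∈ Icc a b) :
    (γ t : H →L[ℂ] H) ξ =
      Complex.exp (Complex.I * ((∫ r in a..t, ψ (rightLogDeriv γ γ' r) : ℝ) : ℂ)) • ξ := by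
  set Φ : ℝ → ℝ := fun t => ∫ r in a..t, ψ (rightLogDeriv γ γ' r) with hΦ
  have hcont : ContinuousOn (fun t => star (γ t : H →L[ℂ] H) ξ) (Icc a b) :=
    (hγ.continuousOn hab).star.clm_apply continuousOn_const
  have hΦc : ContinuousOn (fun t => Complex.exp (Complex.I * (Φ t : ℂ))) (Icc a b) :=
    (continuousOn_const.mul (Complex.continuous_ofReal.comp_continuousOn
      (continuousOn_phase hab hψ hγ hγ'))).cexp
  have hconst := constant_of_has_deriv_right_zero (hΦc.smul hcont) (fun x hx => by
    obtain ⟨d, hd, hlim⟩ := hγ'.exists_deriv_right hγ hx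
    have h1 := hasDerivWithinAt_phase_Ici hψ hγ hγ' hx hd
    have hskew := star_mul_inv_of_hasDerivWithinAt (uniqueDiffWithinAt_Ici x) hd
    have hev : ∀ᶠ r in 𝓝[>] x, r ∈ Icc a b := by
      filter_upwards [Ioo_mem_nhdsGT hx.2] with r hr using ⟨hx.1.trans hr.1.le, hr.2.le⟩
    set l := ψ (d * ((γ x)⁻¹ : unitary (H →L[ℂ] H))) with hl
    have h2 : (d * ((γ x)⁻¹ : unitary (H →L[ℂ] H))) ξ = (Complex.I * (l : ℂ)) • ξ := by
      refine tendsto_nhds_unique_of_eventuallyEq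
        (tendsto_clm_apply (hlim.mul (tendsto_coe_inv
          (hd.continuousWithinAt.mono Ioi_subset_Ici_self))) tendsto_const_nhds)
        (((Complex.continuous_ofReal.tendsto _).comp (tendsto_comp_rightLogDeriv hψ hγ'
          (uniqueDiffWithinAt_Ici x) Ioi_subset_Ici_self hev hd hlim)).const_mul _ |>.smul_const ξ)
        (hev.mono fun r hr => h r hr)
    have h4 : star d ξ = -((Complex.I * (l : ℂ)) • star (γ x : H →L[ℂ] H) ξ) := by
      have e : star d = -(star (γ x : H →L[ℂ] H) * (d * ((γ x)⁻¹ : unitary (H →L[ℂ] H)))) := by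
        rw [← mul_neg, ← hskew, star_mul, ← mul_assoc, ← Unitary.star_eq_inv, Unitary.coe_star,
          star_star, Unitary.star_mul_self_of_mem (γ x).2, one_mul]
      rw [e, neg_apply, mul_apply_eq_comp, h2, map_smul]
    have h3 := (hasDerivWithinAt_cexp h1).smul (hasDerivWithinAt_apply hd.star ξ)
    refine h3.congr_deriv ?_
    rw [h4, ← smul_neg, smul_neg, smul_neg, smul_smul, neg_add_cancel]) t ht
  simp only [hγa, Submonoid.coe_one, one_apply_eq_self, hΦ, star_one,
    intervalIntegral.integral_same, Complex.ofReal_zero, mul_zero, Complex.exp_zero,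
    one_smul, Pi.smul_apply'] at hconst
  have := congrArg (γ t : H →L[ℂ] H) hconst
  rw [map_smul, ← mul_apply_eq_comp, Unitary.mul_star_self_of_mem (γ t).2] at this
  exact this.symm

end Eigenvectors

/-! ### Rigidity, the centred orbit and the spectrum of the endpoint -/

section Main

variable {H : Type*} [NormedAddCommGroup H] [InnerProductSpace ℂ H] [CompleteSpace H]
  {γ : ℝ → unitary (H →L[ℂ] H)} {γ' : ℝ → H →L[ℂ] H} {a b : ℝ}

lemma eigenspace_eq_iInf_of_rigid (hab : a < b) {ψ : (H →L[ℂ] H) → ℝ}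
    (hψ : ContinuousOn ψ {x | star x = -x})
    (hconj : ∀ (g : unitary (H →L[ℂ] H)) (x : H →L[ℂ] H),
      ψ (((g⁻¹ : unitary (H →L[ℂ] H)) : H →L[ℂ] H) * (x * (g : H →L[ℂ] H))) = ψ x)
    (hγ : PiecewiseC1On (fun t => (γ t : H →L[ℂ] H)) a b)
    (hγ' : IsDerivOn (fun t => (γ t : H →L[ℂ] H)) γ' a b) (hγa : γ a = 1)
    (hrigid : ∀ ξ : H, (γ b : H →L[ℂ] H) ξ =
        Complex.exp (Complex.I * ((∫ r in a..b, ψ (rightLogDeriv γ γ' r) : ℝ) : ℂ)) • ξ →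
      ∀ t ∈ Icc a b, (γ t : H →L[ℂ] H) ξ =
        Complex.exp (Complex.I * ((∫ r in a..t, ψ (rightLogDeriv γ γ' r) : ℝ) : ℂ)) • ξ) :
    Module.End.eigenspace ((γ b : H →L[ℂ] H) : H →ₗ[ℂ] H)
        (Complex.exp (Complex.I * ((∫ r in a..b, ψ (rightLogDeriv γ γ' r) : ℝ) : ℂ))) =
      ⨅ t ∈ Icc a b, Module.End.eigenspace (rightLogDeriv γ γ' t : H →ₗ[ℂ] H)
        (Complex.I * (ψ (rightLogDeriv γ γ' t) : ℂ)) ∧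
    Module.End.eigenspace ((γ b : H →L[ℂ] H) : H →ₗ[ℂ] H)
        (Complex.exp (Complex.I * ((∫ r in a..b, ψ (rightLogDeriv γ γ' r) : ℝ) : ℂ))) =
      ⨅ t ∈ Icc a b, Module.End.eigenspace (leftLogDeriv γ γ' t : H →ₗ[ℂ] H)
        (Complex.I * (ψ (leftLogDeriv γ γ' t) : ℂ)) := by
  -- The two logarithmic derivatives are conjugate by `γ t`.
  have hlr : ∀ t, ψ (leftLogDeriv γ γ' t) = ψ (rightLogDeriv γ γ' t) := by
    intro t
    rw [← hconj (γ t) (rightLogDeriv γ γ' t), rightLogDeriv, leftLogDeriv, mul_assoc (γ' t),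
      ← Submonoid.coe_mul, inv_mul_cancel, Submonoid.coe_one, mul_one]
  have hb : b ∈ Icc a b := right_mem_Icc.2 hab.le
  constructor <;> ext ξ <;>
    simp only [Submodule.mem_iInf, Module.End.mem_eigenspace_iff, ContinuousLinearMap.coe_coe, hlr]
  · exact ⟨fun h t ht => rightLogDeriv_apply_eq_of_phase (Complex.exp_ne_zero _) (hrigid ξ h t ht)
      (deriv_apply_eq_of_phase hψ hγ hγ' (hrigid ξ h) ht),
      fun h => apply_eq_phase_of_rightLogDeriv hab hψ hγ hγ' hγa h hb⟩
  · exact ⟨fun h t ht => leftLogDeriv_apply_eq_iff.2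
      (deriv_apply_eq_of_phase hψ hγ hγ' (hrigid ξ h) ht),
      fun h => apply_eq_phase_of_leftLogDeriv hab hψ hγ hγ' hγa h hb⟩

lemma phiMinus_units_conjugate (g : unitary (H →L[ℂ] H)) (x : H →L[ℂ] H) :
    phiMinus (((g⁻¹ : unitary (H →L[ℂ] H)) : H →L[ℂ] H) * (x * (g : H →L[ℂ] H))) = phiMinus x := by
  rw [phiMinus_eq_neg_phiPlus_neg, phiMinus_eq_neg_phiPlus_neg, ← phiPlus_units_conjugate g (-x),
    neg_mul, mul_neg]

/-- The midpoint of the phases `∫ φ₊` and `∫ φ₋`. -/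
noncomputable def phaseMid (γ : ℝ → unitary (H →L[ℂ] H)) (γ' : ℝ → H →L[ℂ] H) (a t : ℝ) : ℝ :=
  ((∫ r in a..t, phiPlus (rightLogDeriv γ γ' r)) +
    ∫ r in a..t, phiMinus (rightLogDeriv γ γ' r)) / 2

/-- Half of the distance of the phases `∫ φ₊` and `∫ φ₋`. -/
noncomputable def phaseRad (γ : ℝ → unitary (H →L[ℂ] H)) (γ' : ℝ → H →L[ℂ] H) (a t : ℝ) : ℝ :=
  ((∫ r in a..t, phiPlus (rightLogDeriv γ γ' r)) -
    ∫ r in a..t, phiMinus (rightLogDeriv γ γ' r)) / 2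

/-- The orbit of `ξ` under the curve `γ`, with the mean phase removed. -/
noncomputable def centredOrbit (γ : ℝ → unitary (H →L[ℂ] H)) (γ' : ℝ → H →L[ℂ] H) (a : ℝ) (ξ : H) (t : ℝ) : H :=
  Complex.exp (Complex.I * ((-phaseMid γ γ' a t : ℝ) : ℂ)) • (γ t : H →L[ℂ] H) ξ

lemma norm_cexp_I_mul (r : ℝ) : ‖Complex.exp (Complex.I * (r : ℂ))‖ = 1 := by
  rw [mul_comm, Complex.norm_exp_ofReal_mul_I]

lemma norm_centredOrbit (ξ : H) (t : ℝ) : ‖centredOrbit γ γ' a ξ t‖ = ‖ξ‖ := by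
  rw [centredOrbit, norm_smul, norm_cexp_I_mul, one_mul, unitary_norm_apply]

lemma centredOrbit_self (hγa : γ a = 1) (ξ : H) : centredOrbit γ γ' a ξ a = ξ := by
  simp [centredOrbit, phaseMid, hγa]

lemma phaseRad_self : phaseRad γ γ' a a = 0 := by simp [phaseRad]

lemma apply_eq_smul_centredOrbit (ξ : H) (t : ℝ) :
    (γ t : H →L[ℂ] H) ξ =
      Complex.exp (Complex.I * (phaseMid γ γ' a t : ℂ)) • centredOrbit γ γ' a ξ t := by
  rw [centredOrbit, smul_smul, ← Complex.exp_add]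
  simp

variable [Nontrivial H]

attribute [local instance] InnerProductSpace.complexToReal

/-- Angles are taken for the real inner product `Re ⟪·, ·⟫`. Removing the mean phase subtracts the
midpoint from `x = γ' γ⁻¹`, so the speed is at most the half-width of its spectrum. -/
lemma angle_centredOrbit_le (hab : a < b) (hγ : PiecewiseC1On (fun t => (γ t : H →L[ℂ] H)) a b)
    (hγ' : IsDerivOn (fun t => (γ t : H →L[ℂ] H)) γ' a b) {ξ : H} (hξ : ‖ξ‖ = 1) {s t : ℝ}
    (hs : a ≤ s) (hst : s ≤ t) (ht : t ≤ b) :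
    InnerProductGeometry.angle (centredOrbit γ γ' a ξ s) (centredOrbit γ γ' a ξ t) ≤
      phaseRad γ γ' a t - phaseRad γ γ' a s := by
  have hP := continuousOn_phase hab continuousOn_phiPlus hγ hγ'
  have hM := continuousOn_phase hab continuousOn_phiMinus hγ hγ'
  have hcont : ContinuousOn (centredOrbit γ γ' a ξ) (Icc a b) := by
    refine ContinuousOn.smul ?_ ((hγ.continuousOn hab).clm_apply continuousOn_const)
    exact (continuousOn_const.mul (Complex.continuous_ofReal.comp_continuousOn
      ((hP.add hM).div_const 2).neg)).cexp
  have hsub : Icc s t ⊆ Icc a b := Icc_subset_Icc hs ht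
  refine angle_le_of_norm_deriv_right_le (hcont.mono hsub)
    (fun r _ => (norm_centredOrbit ξ r).trans hξ) (((hP.sub hM).div_const 2).mono hsub)
    (fun r hr => ?_) (right_mem_Icc.2 hst)
  have hr' : r ∈ Ico a b := ⟨hs.trans hr.1, hr.2.trans_le ht⟩
  obtain ⟨d, hd, -⟩ := hγ'.exists_deriv_right hγ hr'
  have hdP := hasDerivWithinAt_phase_Ici continuousOn_phiPlus hγ hγ' hr' hd
  have hdM := hasDerivWithinAt_phase_Ici continuousOn_phiMinus hγ hγ' hr' hd
  have hskew := star_mul_inv_of_hasDerivWithinAt (uniqueDiffWithinAt_Ici r) hd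
  set x := d * ((γ r)⁻¹ : unitary (H →L[ℂ] H)) with hx
  refine ⟨_, _, (hasDerivWithinAt_cexp ((hdP.add hdM).div_const 2).neg).smul
    (hasDerivWithinAt_apply hd ξ), (hdP.sub hdM).div_const 2, ?_⟩
  have hdx : d ξ = x ((γ r : H →L[ℂ] H) ξ) := by
    rw [hx, mul_apply_eq_comp, unitary_inv_apply_apply]
  rw [mul_smul, ← smul_add, norm_smul, norm_cexp_I_mul, one_mul, hdx]
  have e : x ((γ r : H →L[ℂ] H) ξ) +
      (Complex.I * ((-((phiPlus x + phiMinus x) / 2) : ℝ) : ℂ)) • (γ r : H →L[ℂ] H) ξ =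
      (x - (Complex.I * (((phiPlus x + phiMinus x) / 2 : ℝ) : ℂ)) • (1 : H →L[ℂ] H))
        ((γ r : H →L[ℂ] H) ξ) := by
    rw [Complex.ofReal_neg, mul_neg, neg_smul, ← sub_eq_add_neg]
    rfl
  rw [e]
  refine (ContinuousLinearMap.le_opNorm _ _).trans ?_
  rw [unitary_norm_apply, hξ, mul_one]
  exact norm_sub_midpoint_le hskew

lemma exists_phase_of_mem_spectrum (hab : a < b)
    (hγ : PiecewiseC1On (fun t => (γ t : H →L[ℂ] H)) a b)
    (hγ' : IsDerivOn (fun t => (γ t : H →L[ℂ] H)) γ' a b) (hγa : γ a = 1)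
    (hL : phaseRad γ γ' a b < Real.pi) {z : ℂ} (hz : z ∈ spectrum ℂ (γ b : H →L[ℂ] H)) :
    ∃ θ ∈ Icc (∫ r in a..b, phiMinus (rightLogDeriv γ γ' r))
      (∫ r in a..b, phiPlus (rightLogDeriv γ γ' r)), z = Complex.exp (Complex.I * (θ : ℂ)) := by
  set C := phaseMid γ γ' a b with hC
  set L := phaseRad γ γ' a b with hLdef
  set e := Complex.exp (Complex.I * ((-C : ℝ) : ℂ)) with he
  have he0 : e ≠ 0 := Complex.exp_ne_zero _
  have hw : e * z ∈ spectrum ℂ (e • (γ b : H →L[ℂ] H)) := by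
    have := (spectrum.smul_mem_smul_iff (r := Units.mk0 e he0) (s := z)
      (a := (γ b : H →L[ℂ] H))).2 hz
    simpa [Units.smul_def] using this
  -- The angle bound for every unit vector is a lower bound on the real numerical range of `e • γ
  -- b`.
  have hre : Real.cos L ≤ (e * z).re := by
    refine le_re_of_mem_spectrum (fun ξ hξ => ?_) hw
    have h1 := angle_centredOrbit_le hab hγ hγ' hξ le_rfl hab.le le_rfl
    rw [phaseRad_self, sub_zero, centredOrbit_self hγa] at h1
    have h2 := Real.cos_le_cos_of_nonneg_of_le_pi (InnerProductGeometry.angle_nonneg _ _) hL.le h1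
    rw [InnerProductGeometry.cos_angle, norm_centredOrbit, hξ, mul_one, div_one] at h2
    exact h2
  have hnz : ‖z‖ = 1 := spectrum.norm_eq_one_of_unitary (γ b).2 hz
  have hn : ‖e * z‖ = 1 := by rw [norm_mul, hnz, he, norm_cexp_I_mul, mul_one]
  set τ := Complex.arg (e * z) with hτ
  have hexp : e * z = Complex.exp (Complex.I * (τ : ℂ)) := by
    have := Complex.norm_mul_exp_arg_mul_I (e * z)
    rw [hn, Complex.ofReal_one, one_mul, mul_comm] at this
    exact this.symm
  have hcos : Real.cos L ≤ Real.cos |τ| := by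
    rw [Real.cos_abs]
    rwa [hexp, mul_comm, Complex.exp_ofReal_mul_I_re] at hre
  have hL0 : 0 ≤ L := by
    obtain ⟨ξ, hξ⟩ := exists_norm_eq H (zero_le_one (α := ℝ))
    have h1 := angle_centredOrbit_le hab hγ hγ' hξ le_rfl hab.le le_rfl
    rw [phaseRad_self, sub_zero] at h1
    exact (InnerProductGeometry.angle_nonneg _ _).trans h1
  -- Cosine is strictly decreasing on `[0, π]`, which contains both `L` and `|τ|`.
  have hτL : |τ| ≤ L := by
    by_contra! hlt
    exact absurd (Real.cos_lt_cos_of_nonneg_of_le_pi hL0 (Complex.abs_arg_le_pi _) hlt)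
      (not_lt.2 hcos)
  rw [abs_le] at hτL
  refine ⟨C + τ, ⟨?_, ?_⟩, ?_⟩
  · linarith [hτL.1, (show C - L = ∫ r in a..b, phiMinus (rightLogDeriv γ γ' r) by
      rw [hC, hLdef, phaseMid, phaseRad]; ring)]
  · linarith [hτL.2, (show C + L = ∫ r in a..b, phiPlus (rightLogDeriv γ γ' r) by
      rw [hC, hLdef, phaseMid, phaseRad]; ring)]
  · refine mul_left_cancel₀ he0 ?_
    rw [hexp, he, ← Complex.exp_add]
    congr 1
    push_cast
    ring

lemma centredOrbit_eq_of_extremal (hab : a < b)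
    (hγ : PiecewiseC1On (fun t => (γ t : H →L[ℂ] H)) a b)
    (hγ' : IsDerivOn (fun t => (γ t : H →L[ℂ] H)) γ' a b) (hγa : γ a = 1)
    (hL : phaseRad γ γ' a b < Real.pi) {ε : ℝ} (hε : ε = 1 ∨ ε = -1) {ξ : H}
    (hb : centredOrbit γ γ' a ξ b =
      Complex.exp (Complex.I * ((ε * phaseRad γ γ' a b : ℝ) : ℂ)) • ξ)
    {t : ℝ} (ht : t ∈ Icc a b) :
    centredOrbit γ γ' a ξ t = Complex.exp (Complex.I * ((ε * phaseRad γ γ' a t : ℝ) : ℂ)) • ξ := by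
  have hsmul : ∀ (c : ℂ) (η : H) (r : ℝ),
      centredOrbit γ γ' a (c • η) r = c • centredOrbit γ γ' a η r := by
    intro c η r
    rw [centredOrbit, map_smul, smul_comm, centredOrbit]
  wlog hξ : ‖ξ‖ = 1 generalizing ξ
  · rcases eq_or_ne ξ 0 with rfl | h0
    · simp [centredOrbit]
    have hn : (‖ξ‖ : ℂ) ≠ 0 := by simpa using h0
    have := this (ξ := (‖ξ‖⁻¹ : ℂ) • ξ) (by rw [hsmul, hb, smul_comm])
      (by simp [norm_smul, h0])
    rw [hsmul, smul_comm _ _ ξ] at this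
    exact smul_right_injective H (inv_ne_zero hn) this
  -- The phase orbit of `ξ` is the great circle through `ξ` and `ζ = ε i ξ`, which is orthogonal to
  -- `ξ` for the real inner product.
  have hexp : ∀ r : ℝ, Complex.exp (Complex.I * ((ε * r : ℝ) : ℂ)) • ξ =
      Real.cos r • ξ + Real.sin r • ((ε : ℂ) * Complex.I) • ξ := by
    intro r
    have e : Complex.exp (Complex.I * ((ε * r : ℝ) : ℂ)) =
        (Real.cos r : ℂ) + (Real.sin r : ℂ) * ((ε : ℂ) * Complex.I) := by
      rw [mul_comm, Complex.exp_mul_I]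
      rcases hε with rfl | rfl <;> simp
    rw [e, add_smul, mul_smul, Complex.coe_smul, Complex.coe_smul]
  have h1 := angle_centredOrbit_le hab hγ hγ' hξ le_rfl ht.1 ht.2
  have h2 := angle_centredOrbit_le hab hγ hγ' hξ ht.1 ht.2 le_rfl
  rw [phaseRad_self, sub_zero, centredOrbit_self hγa] at h1
  rw [hb, hexp] at h2
  rw [hexp]
  refine eq_cos_smul_add_sin_smul hξ ?_ ((norm_centredOrbit ξ t).trans hξ) ?_
    ((InnerProductGeometry.angle_nonneg _ _).trans h1)
    (sub_nonneg.1 ((InnerProductGeometry.angle_nonneg _ _).trans h2)) hL h1 h2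
  · rcases hε with rfl | rfl <;> simp [norm_smul, hξ]
  · have h3 : (inner ℂ ξ ξ).im = 0 := inner_self_im (𝕜 := ℂ) ξ
    change (inner ℂ ξ (((ε : ℂ) * Complex.I) • ξ)).re = 0
    rw [inner_smul_right, mul_assoc, Complex.re_ofReal_mul, Complex.I_mul_re, h3, neg_zero, mul_zero]

/-- The extremal phase `C + ε L`, for `ε = ±1`, is attained only by vectors that `γ` moves by the
phase alone. -/
lemma apply_eq_phase_of_extremal (hab : a < b)
    (hγ : PiecewiseC1On (fun t => (γ t : H →L[ℂ] H)) a b)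
    (hγ' : IsDerivOn (fun t => (γ t : H →L[ℂ] H)) γ' a b) (hγa : γ a = 1)
    (hL : phaseRad γ γ' a b < Real.pi) {ε : ℝ} (hε : ε = 1 ∨ ε = -1) {Φ : ℝ → ℝ}
    (hΦ : ∀ t, Φ t = phaseMid γ γ' a t + ε * phaseRad γ γ' a t) {ξ : H}
    (hb : (γ b : H →L[ℂ] H) ξ = Complex.exp (Complex.I * (Φ b : ℂ)) • ξ) {t : ℝ}
    (ht : t ∈ Icc a b) :
    (γ t : H →L[ℂ] H) ξ = Complex.exp (Complex.I * (Φ t : ℂ)) • ξ := by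
  rw [apply_eq_smul_centredOrbit (γ' := γ') (a := a),
    centredOrbit_eq_of_extremal hab hγ hγ' hγa hL hε ?_ ht, smul_smul, ← Complex.exp_add, hΦ]
  · push_cast
    rw [mul_add]
  · rw [centredOrbit, hb, smul_smul, ← Complex.exp_add, hΦ]
    push_cast
    congr 2
    ring

/-- Since `[m, M]` lies inside `(-π, π)`, the principal logarithm is continuous on the spectrum and
inverts `θ ↦ e^{iθ}` there; spectral mapping does the rest. -/
lemma setOf_mem_spectrum_logU {u : unitary (H →L[ℂ] H)} {m M : ℝ} (hm : -Real.pi < m)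
    (hM : M < Real.pi)
    (h : ∀ z ∈ spectrum ℂ (u : H →L[ℂ] H), ∃ θ ∈ Icc m M, z = Complex.exp (Complex.I * (θ : ℂ))) :
    {r : ℝ | (r : ℂ) ∈ spectrum ℂ ((-Complex.I) • logU u)} ⊆ Icc m M ∧
      {r : ℝ | (r : ℂ) ∈ spectrum ℂ ((-Complex.I) • logU u)}.Nonempty := by
  have hlog : ∀ θ ∈ Icc m M, Complex.log (Complex.exp (Complex.I * (θ : ℂ))) =
      Complex.I * (θ : ℂ) := fun θ hθ =>
    Complex.log_exp (by simpa using hm.trans_le hθ.1) (by simpa using hθ.2.trans hM.le)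
  have hcont : ContinuousOn Complex.log (spectrum ℂ (u : H →L[ℂ] H)) := by
    intro z hz
    obtain ⟨θ, hθ, rfl⟩ := h z hz
    refine (continuousAt_clog ?_).continuousWithinAt
    rw [Complex.mem_slitPlane_iff_arg]
    refine ⟨?_, Complex.exp_ne_zero _⟩
    rw [← Complex.log_im, hlog θ hθ]
    simpa using (hθ.2.trans_lt hM).ne
  have hspec : spectrum ℂ ((-Complex.I) • logU u) =
      (fun z => (-Complex.I) • Complex.log z) '' spectrum ℂ (u : H →L[ℂ] H) := by
    rw [logU, ← cfc_smul _ _ _ hcont]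
    exact cfc_map_spectrum _ _ (by cfc_tac) (ContinuousOn.fun_const_smul hcont _)
  have hval : ∀ θ ∈ Icc m M, (-Complex.I) • Complex.log (Complex.exp (Complex.I * (θ : ℂ))) =
      (θ : ℂ) := fun θ hθ => by
    rw [hlog θ hθ, smul_eq_mul, ← mul_assoc]
    simp
  rw [hspec]
  constructor
  · rintro r ⟨z, hz, hzr⟩
    obtain ⟨θ, hθ, rfl⟩ := h z hz
    have : (-Complex.I) • Complex.log (Complex.exp (Complex.I * (θ : ℂ))) = (r : ℂ) := hzr
    rw [hval θ hθ, Complex.ofReal_inj] at this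
    exact this ▸ hθ
  · obtain ⟨z, hz⟩ := spectrum.nonempty (u : H →L[ℂ] H)
    obtain ⟨θ, hθ, rfl⟩ := h z hz
    exact ⟨θ, _, hz, hval θ hθ⟩

end Main

end UnitaryCurve

theorem theorem4p3 {H : Type*} [NormedAddCommGroup H] [InnerProductSpace ℂ H] [CompleteSpace H]
    [Nontrivial H] {a b : ℝ} (hab : a < b)
    (γ : ℝ → unitary (H →L[ℂ] H)) (γ' : ℝ → H →L[ℂ] H)
    (hγ : PiecewiseC1On (fun t => (γ t : H →L[ℂ] H)) a b)
    (hγ' : IsDerivOn (fun t => (γ t : H →L[ℂ] H)) γ' a b)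
    (hγa : γ a = 1)
    (hplus : (∫ t in a..b, phiPlus (rightLogDeriv γ γ' t)) < Real.pi)
    (hminus : -Real.pi < ∫ t in a..b, phiMinus (rightLogDeriv γ γ' t)) :
    (-1 : ℂ) ∉ spectrum ℂ (γ b : H →L[ℂ] H) ∧
    thetaPlus (γ b) ≤ ∫ t in a..b, phiPlus (rightLogDeriv γ γ' t) ∧
    (∫ t in a..b, phiMinus (rightLogDeriv γ γ' t)) ≤ thetaMinus (γ b) ∧
    (thetaPlus (γ b) = ∫ t in a..b, phiPlus (rightLogDeriv γ γ' t) →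
      unitaryEigPlus (γ b) = ⨅ t ∈ Set.Icc a b, skewEigPlus (rightLogDeriv γ γ' t) ∧
      unitaryEigPlus (γ b) = ⨅ t ∈ Set.Icc a b, skewEigPlus (leftLogDeriv γ γ' t)) ∧
    (thetaMinus (γ b) = ∫ t in a..b, phiMinus (rightLogDeriv γ γ' t) →
      unitaryEigMinus (γ b) = ⨅ t ∈ Set.Icc a b, skewEigMinus (rightLogDeriv γ γ' t) ∧
      unitaryEigMinus (γ b) = ⨅ t ∈ Set.Icc a b, skewEigMinus (leftLogDeriv γ γ' t)) := by
  have hL : phaseRad γ γ' a b < Real.pi := by rw [phaseRad]; linarith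
  have hspec := fun z hz => exists_phase_of_mem_spectrum hab hγ hγ' hγa hL (z := z) hz
  obtain ⟨hsub, hne⟩ := setOf_mem_spectrum_logU hminus hplus hspec
  refine ⟨fun h => ?_, csSup_le hne fun r hr => (hsub hr).2, le_csInf hne fun r hr => (hsub hr).1,
    fun h => ?_, fun h => ?_⟩
  · obtain ⟨θ, hθ, he⟩ := hspec _ h
    -- The principal argument of `-1` is `π`, which would force `θ = π`, beyond the bound `∫ φ₊ <
    -- π`.
    have h1 := congrArg (fun z => (Complex.log z).im) he
    simp only [Complex.log_im, Complex.arg_neg_one] at h1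
    rw [← Complex.log_im, Complex.log_exp (by simpa using hminus.trans_le hθ.1)
      (by simpa using hθ.2.trans hplus.le)] at h1
    have h2 : Real.pi = θ := by simpa using h1
    linarith [hθ.2]
  · rw [unitaryEigPlus, h]
    exact eigenspace_eq_iInf_of_rigid hab continuousOn_phiPlus phiPlus_units_conjugate hγ hγ' hγa
      -- The sign is `ε = 1` because `∫ φ₊ = C + L`; the lower case takes `ε = -1`.
      fun ξ hξ t ht => apply_eq_phase_of_extremal hab hγ hγ' hγa hL (Or.inl rfl)
        (Φ := fun t => ∫ r in a..t, phiPlus (rightLogDeriv γ γ' r))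
        (fun t => by rw [phaseMid, phaseRad]; ring) hξ ht
  · rw [unitaryEigMinus, h]
    exact eigenspace_eq_iInf_of_rigid hab continuousOn_phiMinus phiMinus_units_conjugate hγ hγ' hγa
      fun ξ hξ t ht => apply_eq_phase_of_extremal hab hγ hγ' hγa hL (Or.inr rfl)
        (Φ := fun t => ∫ r in a..t, phiMinus (rightLogDeriv γ γ' r))
        (fun t => by rw [phaseMid, phaseRad]; ring) hξ ht
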